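/- Let $\mathbb{K}$ be an algebraically closed field of characteristic zero. For a Lie algebra $\mathfrak g$ put $\mathfrak g^0=\mathfrak g$ and $\mathfrak g^{i+1}=[\mathfrak g,\mathfrak g^i]$. For a finite simple graph $G=(V,E)$ and $k\ge 1$, let $L$ be the free Lie algebra over $\mathbb{K}$ on the set $V$, let $L_{(k)}=L/L^{k}$ be the free $k$-step nilpotent Lie algebra on $V$, and let $$\mathfrak g(k,G)=L_{(k)}/I,$$ where $I$ is the ideal of $L_{(k)}$ generated by the brackets $[v,w]$ of distinct vertices $v,w\in V$ with $\{v,w\}\notin E$. This is a finite-dimensional Lie algebra with $\mathfrak g(k,G)^k=0$, called the $k$-step graph Lie algebra of $G$. Let $\mathcal N_{n,k}$ be the variety of all Lie brackets $\mu$ on $\mathbb{K}^n$ that are at most $k$-step nilpotent (that is, $(\mathbb{K}^n,\mu)^k=0$), with the Zariski topology induced from the affine space of bilinear maps $\mathbb{K}^n\times\mathbb{K}^n\to\mathbb{K}^n$, and let $GL(n,\mathbb{K})$ act on it by $(g\cdot\mu)(x,y)=g\,\mu(g^{-1}x,g^{-1}y)$. A Lie algebra $\mathfrak g$ of dimension $n$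 with $\mathfrak g^k=0$ is called $k$-rigid if the $GL(n,\mathbb{K})$-orbit of the bracket it induces on $\mathbb{K}^n$ (through any basis of $\mathfrak g$) is open in $\mathcal N_{n,k}$. **Theorem.** Let $G=(V,E)$ be a finite simple graph with $|V|\ge 3$ which is not a complete graph, and let $k\ge 3$. Then $\mathfrak g(k,G)$ is not $k$-rigid. -/

import Mathlib

/-! ### The `k`-step graph Lie algebra -/

/-- The free `k`-step nilpotent Lie algebra on `V`: the free Lie algebra modulo the `k`-th term of
its descending central series `𝔤⁰ = 𝔤`, `𝔤ⁱ⁺¹ = [𝔤, 𝔤ⁱ]`. -/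
abbrev FreeNilpotentLieAlgebra (K : Type*) [Field K] (k : ℕ) (V : Type*) :=
  FreeLieAlgebra K V ⧸
    LieModule.lowerCentralSeries K (FreeLieAlgebra K V) (FreeLieAlgebra K V) k

namespace FreeNilpotentLieAlgebra

/-- The generator of the free `k`-step nilpotent Lie algebra given by `v ∈ V`. -/
noncomputable def of (K : Type*) [Field K] (k : ℕ) {V : Type*} (v : V) : FreeNilpotentLieAlgebra K k V :=
  LieSubmodule.Quotient.mk (FreeLieAlgebra.of K v)

end FreeNilpotentLieAlgebra

/-- The ideal of the free `k`-step nilpotent Lie algebra on the vertices of `G` generated by the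
brackets of the pairs of distinct vertices that are not joined by an edge. -/
noncomputable def nonEdgeIdeal (K : Type*) [Field K] (k : ℕ) {V : Type*} (G : SimpleGraph V) :
    LieIdeal K (FreeNilpotentLieAlgebra K k V) :=
  LieSubmodule.lieSpan K (FreeNilpotentLieAlgebra K k V)
    {x | ∃ v w : V, v ≠ w ∧ ¬ G.Adj v w ∧
      x = ⁅FreeNilpotentLieAlgebra.of K k v, FreeNilpotentLieAlgebra.of K k w⁆}

/-- The `k`-step graph Lie algebra `𝔤(k, G)`. -/
abbrev GraphLieAlgebra (K : Type*) [Field K] (k : ℕ) {V : Type*} (G : SimpleGraph V) :=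
  FreeNilpotentLieAlgebra K k V ⧸ nonEdgeIdeal K k G

/-! ### `𝔤(k, G)` is at most `k`-step nilpotent and finite dimensional -/

namespace GraphLieAlgebra

/-- The projection of a Lie algebra onto its quotient by an ideal. -/
def proj {K L : Type*} [Field K] [LieRing L] [LieAlgebra K L] (I : LieIdeal K L) :
    L →ₗ⁅K⁆ L ⧸ I :=
  { (LieSubmodule.Quotient.mk' I : L →ₗ[K] L ⧸ I) with
    map_lie' := fun {x y} => LieSubmodule.Quotient.mk_bracket I x y }

theorem proj_surjective {K L : Type*} [Field K] [LieRing L] [LieAlgebra K L] (I : LieIdeal K L) :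
    Function.Surjective (proj I) :=
  LieSubmodule.Quotient.surjective_mk' I

theorem lowerCentralSeries_quotient_eq_bot {K L : Type*} [Field K] [LieRing L] [LieAlgebra K L]
    (I : LieIdeal K L) (k : ℕ) (h : LieModule.lowerCentralSeries K L L k ≤ I) :
    LieModule.lowerCentralSeries K (L ⧸ I) (L ⧸ I) k = ⊥ := by
  rw [← LieIdeal.lowerCentralSeries_map_eq k (proj_surjective I), eq_bot_iff,
    LieIdeal.map_le_iff_le_comap]
  intro x hx
  rw [LieIdeal.mem_comap, LieSubmodule.mem_bot]
  exact (LieSubmodule.Quotient.mk_eq_zero I).2 (h hx)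

/-- `𝔤(k, G)` is at most `k`-step nilpotent. -/
theorem lowerCentralSeries_eq_bot (K : Type*) [Field K] (k : ℕ) {V : Type*} (G : SimpleGraph V) :
    LieModule.lowerCentralSeries K (GraphLieAlgebra K k G) (GraphLieAlgebra K k G) k = ⊥ := by
  refine lowerCentralSeries_quotient_eq_bot _ k ?_
  rw [lowerCentralSeries_quotient_eq_bot _ k le_rfl]
  exact bot_le

theorem subalgebra_eq_top {K V : Type*} [Field K] (A : LieSubalgebra K (FreeLieAlgebra K V))
    (h : ∀ v, FreeLieAlgebra.of K v ∈ A) : A = ⊤ := by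
  have key : A.incl.comp (FreeLieAlgebra.lift K fun v => (⟨FreeLieAlgebra.of K v, h v⟩ : A)) =
      LieHom.id := by
    ext v; simp
  refine eq_top_iff.2 fun x _ => ?_
  have := congrArg (fun f => f x) key
  simp only [LieHom.comp_apply, LieHom.id_apply] at this
  rw [← this]
  exact Subtype.prop _

theorem finite_of_surjective {K V L : Type*} [Field K] [Finite V] [LieRing L] [LieAlgebra K L]
    (f : FreeLieAlgebra K V →ₗ⁅K⁆ L) (hf : Function.Surjective f) (k : ℕ)
    (hk : LieModule.lowerCentralSeries K L L k = ⊥) : Module.Finite K L := by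
  have gen : ∀ A : LieSubalgebra K L, (∀ v, f (FreeLieAlgebra.of K v) ∈ A) → ∀ x, x ∈ A := by
    intro A hA x
    obtain ⟨y, rfl⟩ := hf x
    have := subalgebra_eq_top (A.comap f) hA
    have hy : y ∈ A.comap f := by rw [this]; trivial
    exact hy
  let W : Submodule K L := Submodule.span K (Set.range fun v => f (FreeLieAlgebra.of K v))
  let br : L →ₗ[K] L →ₗ[K] L := (LieModule.toEnd K L L : L →ₗ[K] Module.End K L)
  let P : ℕ → Submodule K L := fun i => Nat.rec W (fun _ p => Submodule.map₂ br W p) i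
  have hPs : ∀ i, P (i + 1) = Submodule.map₂ br W (P i) := fun i => rfl
  have hPl : ∀ i, P i ≤ (LieModule.lowerCentralSeries K L L i).toSubmodule := by
    intro i
    induction i with
    | zero => simp
    | succ i ih =>
      rw [hPs, Submodule.map₂_le]
      intro x _ y hy
      rw [LieModule.lowerCentralSeries_succ]
      exact LieSubmodule.lie_mem_lie (LieSubmodule.mem_top x) (ih hy)
  have hPf : ∀ i, (P i).FG := by
    intro i
    induction i with
    | zero => exact Submodule.fg_span (Set.finite_range _)
    | succ i ih => exact Submodule.FG.map₂ _ (Submodule.fg_span (Set.finite_range _)) ih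
  let Q : Submodule K L := ⨆ i : Fin (k + 1), P i
  have hQ : ∀ v, ∀ x ∈ Q, ⁅f (FreeLieAlgebra.of K v), x⁆ ∈ Q := by
    intro v
    suffices Q ≤ Q.comap (br (f (FreeLieAlgebra.of K v))) from fun x hx => this hx
    refine iSup_le fun i x hx => ?_
    have hm : ⁅f (FreeLieAlgebra.of K v), x⁆ ∈ P (i + 1) :=
      Submodule.apply_mem_map₂ br (Submodule.subset_span ⟨v, rfl⟩) hx
    by_cases hi : (i : ℕ) + 1 < k + 1
    · exact (le_iSup (fun i : Fin (k + 1) => P i) ⟨i + 1, hi⟩) hm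
    · have hik : (i : ℕ) = k := by omega
      have : x ∈ (LieModule.lowerCentralSeries K L L k).toSubmodule := hPl k (hik ▸ hx)
      rw [hk] at this
      have hx0 : x = 0 := by simpa using this
      subst hx0
      simp
  let N : LieSubalgebra K L :=
    { carrier := {x | ∀ y ∈ Q, ⁅x, y⁆ ∈ Q}
      add_mem' := fun ha hb y hy => by rw [add_lie]; exact Q.add_mem (ha y hy) (hb y hy)
      zero_mem' := fun y _ => by simp
      smul_mem' := fun c a ha y hy => by rw [smul_lie]; exact Q.smul_mem c (ha y hy)
      lie_mem' := fun {a b} ha hb y hy => by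
        rw [lie_lie]; exact Q.sub_mem (ha _ (hb y hy)) (hb _ (ha y hy)) }
  have hN : ∀ x, ∀ y ∈ Q, ⁅x, y⁆ ∈ Q := gen N hQ
  have hT : ∀ x, x ∈ Q :=
    gen { Q with lie_mem' := fun {a b} _ hb => hN a b hb }
      fun v => (le_iSup (fun i : Fin (k + 1) => P i) 0) (Submodule.subset_span ⟨v, rfl⟩)
  have hQT : Q = ⊤ := eq_top_iff.2 fun x _ => hT x
  refine ⟨hQT ▸ Submodule.fg_iSup _ fun i => hPf i⟩

instance finite (K : Type*) [Field K] (k : ℕ) {V : Type*} [Finite V] (G : SimpleGraph V) :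
    Module.Finite K (GraphLieAlgebra K k G) := by
  exact finite_of_surjective ((proj (nonEdgeIdeal K k G)).comp (proj _))
    ((proj_surjective _).comp (proj_surjective _)) k (lowerCentralSeries_eq_bot K k G)

end GraphLieAlgebra

/-! ### The variety of at most `k`-step nilpotent Lie brackets on `Kⁿ` and rigidity -/

/-- Bilinear maps `Kⁿ × Kⁿ → Kⁿ`. -/
abbrev BilinearBracket (K : Type*) [Field K] (n : ℕ) :=
  (Fin n → K) →ₗ[K] (Fin n → K) →ₗ[K] (Fin n → K)

namespace BilinearBracket

variable {K : Type*} [Field K] {n : ℕ}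

/-- `μ` is a Lie bracket: alternating, with the Jacobi identity. -/
def IsLieBracket (μ : BilinearBracket K n) : Prop :=
  (∀ x, μ x x = 0) ∧
    ∀ x y z, μ x (μ y z) + μ y (μ z x) + μ z (μ x y) = 0

/-- The descending central series of `μ`: `𝔤⁰ = Kⁿ`, `𝔤ⁱ⁺¹ = μ(Kⁿ, 𝔤ⁱ)`. -/
def centralSeries (μ : BilinearBracket K n) : ℕ → Submodule K (Fin n → K)
  | 0 => ⊤
  | i + 1 => Submodule.map₂ μ ⊤ (centralSeries μ i)

variable (K n) in
/-- The variety `𝒩_{n,k}` of Lie brackets on `Kⁿ` that are at most `k`-step nilpotent. -/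
def nilpotentVariety (k : ℕ) : Set (BilinearBracket K n) :=
  {μ | μ.IsLieBracket ∧ μ.centralSeries k = ⊥}

/-- The action of `GL(n, K)` on brackets, `(g • μ)(x, y) = g μ(g⁻¹ x, g⁻¹ y)`. -/
def act (g : (Fin n → K) ≃ₗ[K] (Fin n → K)) (μ : BilinearBracket K n) : BilinearBracket K n :=
  (μ.compl₁₂ g.symm.toLinearMap g.symm.toLinearMap).compr₂ g.toLinearMap

/-- The orbit of `μ` under `GL(n, K)`, that is, its isomorphism class. -/
def orbit (μ : BilinearBracket K n) : Set (BilinearBracket K n) :=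
  Set.range fun g : (Fin n → K) ≃ₗ[K] (Fin n → K) => act g μ

/-- The structure constants of `μ` in the standard basis of `Kⁿ`, i.e. the coordinates of `μ` in
the affine space of bilinear maps: `μ(e_i, e_j) = ∑ l, c (i, j, l) e_l`. -/
def structureConstants (μ : BilinearBracket K n) : Fin n × Fin n × Fin n → K :=
  fun p => μ (Pi.single p.1 1) (Pi.single p.2.1 1) p.2.2

/-- `U` is a Zariski open subset of `X` (for the topology induced on `X` by the Zariski topology of
the affine space of bilinear maps): it is the complement in `X` of the common zero set of some
polynomials in the structure constants. -/
def IsZariskiOpenIn (X U : Set (BilinearBracket K n)) : Prop :=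
  ∃ S : Set (MvPolynomial (Fin n × Fin n × Fin n) K),
    U = {μ ∈ X | ¬ ∀ p ∈ S, MvPolynomial.eval μ.structureConstants p = 0}

/-- `μ ∈ 𝒩_{n,k}` is `k`-rigid: its orbit is Zariski open in `𝒩_{n,k}`. -/
def IsRigid (k : ℕ) (μ : BilinearBracket K n) : Prop :=
  μ ∈ nilpotentVariety K n k ∧ IsZariskiOpenIn (nilpotentVariety K n k) μ.orbit

/-- The bracket of a Lie algebra of dimension `n`, transported to `Kⁿ` by a basis. -/
noncomputable def ofBasis {L : Type*} [LieRing L] [LieAlgebra K L]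
    (b : Module.Basis (Fin n) K L) : BilinearBracket K n :=
  LinearMap.mk₂ K (fun x y => b.equivFun ⁅b.equivFun.symm x, b.equivFun.symm y⁆)
    (by intros; simp only [map_add, add_lie]) (by intros; simp only [map_smul, smul_lie])
    (by intros; simp only [map_add, lie_add]) (by intros; simp only [map_smul, lie_smul])

end BilinearBracket

/-- A finite-dimensional Lie algebra is `k`-rigid if the bracket that it induces on `Kⁿ`, where `n`
is its dimension, through some basis is `k`-rigid. Another basis gives a bracket in the same
`GL(n, K)`-orbit, so the choice of the basis is immaterial. -/
def IsKRigid (K : Type*) [Field K] (k : ℕ) (L : Type*) [LieRing L] [LieAlgebra K L]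
    [Module.Finite K L] : Prop :=
  ∃ b : Module.Basis (Fin (Module.finrank K L)) K L, (BilinearBracket.ofBasis b).IsRigid k

/-! ### Linear deformations and rigidity -/

section Deformation

/-! An open orbit meets every line of deformations through it at some `t ≠ 0`, so it suffices to
find one line in the variety whose members with `t ≠ 0` are not isomorphic to 𝔤 = 𝔤(k, G). The lines
used add `t (α ∧ β) z`, with `z` central and `α`, `β` killing brackets and `z`
(`IsKRigid.exists_equiv_deformation`).

If some edge `uv` has a vertex `w ≠ v` not adjacent to `v`, take for `α`, `β` the coordinates at
`v`, `w` and `z = (ad u)^(k-1) v`. As `k ≥ 3`, an isomorphism `f` onto the deformation is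
multiplicative modulo 𝔤², so its linear part extends to an automorphism. This yields commuting `x`,
`y` with `f x`, `f y` congruent to `v`, `w` modulo brackets (`exists_abelianize_eq_single`), whence
`⁅f x, f y⁆ = -t z`. The filiform quotient given by `uv` kills the left side, as neither factor has
a `u`-coordinate, but not `z`.

Otherwise `G`, not being complete, has no edges: 𝔤 is abelian of dimension at least 3 and deforms to
a non-abelian algebra. -/

open Polynomial in
theorem exists_ne_zero_eval_line_ne_zero {K σ : Type*} [Field K] [Infinite K]
    (p : MvPolynomial σ K) (c d : σ → K) (h : MvPolynomial.eval c p ≠ 0) :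
    ∃ t : K, t ≠ 0 ∧ MvPolynomial.eval (fun i => c i + t * d i) p ≠ 0 := by
  let P : K[X] := MvPolynomial.aeval (fun i => C (c i) + X * C (d i)) p
  have hP : ∀ t, P.eval t = MvPolynomial.eval (fun i => c i + t * d i) p := by
    intro t
    have : (Polynomial.evalRingHom t).comp
        (MvPolynomial.aeval (fun i => C (c i) + X * C (d i)) :
          MvPolynomial σ K →ₐ[K] K[X]).toRingHom =
        MvPolynomial.eval (fun i => c i + t * d i) := by
      ext i
      · simp
      · simpa using mul_comm _ _
    exact congrArg (fun f => f p) this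
  -- The factor `X` excludes the parameter `t = 0`.
  have hne : P * X ≠ 0 := by
    refine mul_ne_zero ?_ X_ne_zero
    rintro h0
    apply h
    have := hP 0
    simpa [h0] using this.symm
  by_contra! hcon
  refine hne (Polynomial.funext fun t => ?_)
  by_cases ht : t = 0
  · simp [ht]
  · simp [hP, hcon t ht]

variable {K L : Type*} [Field K] [LieRing L] [LieAlgebra K L]

/-- The alternating bilinear map `(x, y) ↦ (α x * β y - β x * α y) • z`. -/
def wedgeSmul (α β : L →ₗ[K] K) (z : L) : L →ₗ[K] L →ₗ[K] L :=
  LinearMap.mk₂ K (fun x y => (α x * β y - β x * α y) • z)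
    (by intros; simp only [map_add, ← add_smul]; congr 1; ring)
    (by intros; simp only [map_smul, smul_eq_mul, smul_smul]; congr 1; ring)
    (by intros; simp only [map_add, ← add_smul]; congr 1; ring)
    (by intros; simp only [map_smul, smul_eq_mul, smul_smul]; congr 1; ring)

@[simp]
theorem wedgeSmul_apply (α β : L →ₗ[K] K) (z x y : L) :
    wedgeSmul α β z x y = (α x * β y - β x * α y) • z := rfl

variable {n : ℕ}

/-- The bracket `⁅x, y⁆ + t • φ x y`, transported to `Kⁿ` by a basis. -/
noncomputable def deformedBracket (b : Module.Basis (Fin n) K L) (φ : L →ₗ[K] L →ₗ[K] L) (t : K) :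
    BilinearBracket K n :=
  BilinearBracket.ofBasis b +
    t • (φ.compl₁₂ b.equivFun.symm.toLinearMap b.equivFun.symm.toLinearMap).compr₂
      b.equivFun.toLinearMap

theorem deformedBracket_apply (b : Module.Basis (Fin n) K L) (φ : L →ₗ[K] L →ₗ[K] L) (t : K)
    (x y : Fin n → K) :
    deformedBracket b φ t x y =
      b.equivFun (⁅b.equivFun.symm x, b.equivFun.symm y⁆ +
        t • φ (b.equivFun.symm x) (b.equivFun.symm y)) := by
  rw [map_add, map_smul]; rfl

/-- The added term is invisible in double brackets: inside it is a multiple of the central `z`, on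
which `α` and `β` vanish, and outside `α` and `β` meet only brackets. Jacobi and nilpotency involve
only double brackets once `k ≥ 2`. -/
theorem deformedBracket_mem_nilpotentVariety (b : Module.Basis (Fin n) K L) {k : ℕ} (hk : 2 ≤ k)
    (hL : LieModule.lowerCentralSeries K L L k = ⊥) {α β : L →ₗ[K] K} {z : L}
    (hα : ∀ x y : L, α ⁅x, y⁆ = 0) (hβ : ∀ x y : L, β ⁅x, y⁆ = 0) (hαz : α z = 0) (hβz : β z = 0)
    (hz : ∀ x : L, ⁅x, z⁆ = 0) (t : K) :
    deformedBracket b (wedgeSmul α β z) t ∈ BilinearBracket.nilpotentVariety K n k := by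
  set μ := deformedBracket b (wedgeSmul α β z) t with hμ
  have key : ∀ x y w, μ x (μ y w) =
      b.equivFun ⁅b.equivFun.symm x, ⁅b.equivFun.symm y, b.equivFun.symm w⁆⁆ := by
    intro x y w
    simp only [hμ, deformedBracket_apply, LinearEquiv.symm_apply_apply, wedgeSmul_apply, map_add,
      map_smul, hα, hβ, hαz, hβz, hz]
    simp
  refine ⟨⟨fun x => ?_, fun x y w => ?_⟩, ?_⟩
  · rw [hμ, deformedBracket_apply, wedgeSmul_apply, lie_self, mul_comm, sub_self, zero_smul,
      smul_zero, add_zero, map_zero]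
  · rw [key, key, key, ← map_add, ← map_add, lie_jacobi, map_zero]
  -- The comparison starts at index 2, since at index 1 the new series may contain `z` when the old
  -- one does not.
  · have h2 : ∀ i, μ.centralSeries (i + 2) ≤
        ((LieModule.lowerCentralSeries K L L (i + 2)).toSubmodule).map
          b.equivFun.toLinearMap := by
      intro i
      induction i with
      | zero =>
        change Submodule.map₂ μ ⊤ (Submodule.map₂ μ ⊤ ⊤) ≤ _
        rw [Submodule.map₂_le]
        intro x _ m hm
        suffices Submodule.map₂ μ ⊤ ⊤ ≤ (Submodule.map b.equivFun.toLinearMap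
            (LieModule.lowerCentralSeries K L L (0 + 2)).toSubmodule).comap (μ x) from this hm
        rw [Submodule.map₂_le]
        intro y _ w _
        rw [Submodule.mem_comap, key]
        refine Submodule.mem_map_of_mem ?_
        simp only [zero_add, LieModule.lowerCentralSeries_succ, LieModule.lowerCentralSeries_zero]
        exact LieSubmodule.lie_mem_lie (LieSubmodule.mem_top _)
          (LieSubmodule.lie_mem_lie (LieSubmodule.mem_top _) (LieSubmodule.mem_top _))
      | succ i ih =>
        change Submodule.map₂ μ ⊤ (μ.centralSeries (i + 2)) ≤ _
        rw [Submodule.map₂_le]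
        intro x _ m hm
        obtain ⟨m', hm', rfl⟩ := ih hm
        have hαβ : α m' = 0 ∧ β m' = 0 := by
          have h1 : m' ∈ (LieModule.lowerCentralSeries K L L 1).toSubmodule :=
            LieModule.antitone_lowerCentralSeries K L L (by omega : 1 ≤ i + 2) hm'
          rw [LieModule.lowerCentralSeries_succ, LieModule.lowerCentralSeries_zero,
            LieSubmodule.lieIdeal_oper_eq_linear_span'] at h1
          suffices Submodule.span K {x : L | ∃ y ∈ (⊤ : LieIdeal K L), ∃ w ∈
            (⊤ : LieSubmodule K L L), ⁅y, w⁆ = x} ≤ LinearMap.ker α ⊓ LinearMap.ker β from this h1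
          rw [Submodule.span_le]
          rintro _ ⟨y, -, w, -, rfl⟩
          exact ⟨hα y w, hβ y w⟩
        refine ⟨⁅b.equivFun.symm x, m'⁆, ?_, ?_⟩
        · change _ ∈ LieModule.lowerCentralSeries K L L ((i + 2) + 1)
          rw [LieModule.lowerCentralSeries_succ]
          exact LieSubmodule.lie_mem_lie (LieSubmodule.mem_top _) hm'
        · simp only [hμ, deformedBracket_apply, LinearEquiv.coe_coe, LinearEquiv.symm_apply_apply,
            wedgeSmul_apply, hαβ.1, hαβ.2]
          simp
    obtain ⟨i, rfl⟩ := Nat.exists_eq_add_of_le' hk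
    have := h2 i
    rw [hL] at this
    simpa using this

/-- If the orbit of a nilpotent Lie algebra is open, then it is isomorphic to some non-trivial
member of each of its central linear deformations. -/
theorem IsKRigid.exists_equiv_deformation [Infinite K] [Module.Finite K L] {k : ℕ} (hk : 2 ≤ k)
    (h : IsKRigid K k L)
    (hL : LieModule.lowerCentralSeries K L L k = ⊥) {α β : L →ₗ[K] K} {z : L}
    (hα : ∀ x y : L, α ⁅x, y⁆ = 0) (hβ : ∀ x y : L, β ⁅x, y⁆ = 0) (hαz : α z = 0) (hβz : β z = 0)
    (hz : ∀ x : L, ⁅x, z⁆ = 0) :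
    ∃ t : K, t ≠ 0 ∧ ∃ f : L ≃ₗ[K] L, ∀ x y,
      f ⁅x, y⁆ = ⁅f x, f y⁆ + t • (α (f x) * β (f y) - β (f x) * α (f y)) • z := by
  obtain ⟨b, -, S, hS⟩ := h
  have hmem : BilinearBracket.ofBasis b ∈ (BilinearBracket.ofBasis b).orbit :=
    ⟨LinearEquiv.refl K _, rfl⟩
  rw [hS] at hmem
  obtain ⟨-, hp⟩ := hmem
  push Not at hp
  obtain ⟨p, hpS, hp⟩ := hp
  obtain ⟨t, ht, hpt⟩ := exists_ne_zero_eval_line_ne_zero p _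
    (BilinearBracket.structureConstants
      (((wedgeSmul α β z).compl₁₂ b.equivFun.symm.toLinearMap b.equivFun.symm.toLinearMap).compr₂
        b.equivFun.toLinearMap)) hp
  have horb : deformedBracket b (wedgeSmul α β z) t ∈ (BilinearBracket.ofBasis b).orbit := by
    rw [hS]
    exact ⟨deformedBracket_mem_nilpotentVariety b hk hL hα hβ hαz hβz hz t,
      fun hall => hpt (hall p hpS)⟩
  obtain ⟨g, hg⟩ := horb
  refine ⟨t, ht, (b.equivFun.trans g).trans b.equivFun.symm, fun x y => ?_⟩
  -- Evaluating at images under `g` cancels the inverses in the action.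
  have := congrArg (fun μ => b.equivFun.symm (μ (g (b.equivFun x)) (g (b.equivFun y)))) hg
  simp only [deformedBracket_apply, LinearEquiv.symm_apply_apply, wedgeSmul_apply] at this
  rw [LinearEquiv.trans_apply, LinearEquiv.trans_apply, LinearEquiv.trans_apply,
    LinearEquiv.trans_apply, LinearEquiv.trans_apply, LinearEquiv.trans_apply, ← this]
  simp [BilinearBracket.act, BilinearBracket.ofBasis]

end Deformation

/-! ### Generators and homomorphisms of graph Lie algebras -/

/-- Serves to prove nilpotency of the coordinate models below by exhibiting an explicit filtration.
-/
theorem LieModule.lowerCentralSeries_le_of_lie_mem {K M : Type*} [Field K] [LieRing M]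
    [LieAlgebra K M] (P : ℕ → Submodule K M) (h0 : P 0 = ⊤)
    (hs : ∀ i, ∀ x : M, ∀ m ∈ P i, ⁅x, m⁆ ∈ P (i + 1)) (i : ℕ) :
    (LieModule.lowerCentralSeries K M M i).toSubmodule ≤ P i := by
  induction i with
  | zero => simp [h0]
  | succ i ih =>
    rw [LieModule.lowerCentralSeries_succ, LieSubmodule.lieIdeal_oper_eq_linear_span',
      Submodule.span_le]
    rintro _ ⟨x, -, m, hm, rfl⟩
    exact hs i x m (ih hm)

theorem LieHom.map_lowerCentralSeries_mem {K L M : Type*} [Field K] [LieRing L]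
    [LieAlgebra K L] [LieRing M] [LieAlgebra K M] (f : L →ₗ⁅K⁆ M) {i : ℕ} {x : L}
    (hx : x ∈ LieModule.lowerCentralSeries K L L i) :
    f x ∈ LieModule.lowerCentralSeries K M M i :=
  LieIdeal.map_lowerCentralSeries_le i (LieIdeal.mem_map hx)

/-- A homomorphism of Lie algebras that vanishes on an ideal factors through the quotient. -/
def LieIdeal.quotientLift {K L M : Type*} [Field K] [LieRing L] [LieAlgebra K L] [LieRing M]
    [LieAlgebra K M] (I : LieIdeal K L) (f : L →ₗ⁅K⁆ M) (h : I ≤ f.ker) : L ⧸ I →ₗ⁅K⁆ M :=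
  { I.toSubmodule.liftQ (f : L →ₗ[K] M) (fun _ hx => h hx) with
    map_lie' := by
      intro x y
      obtain ⟨x, rfl⟩ := LieSubmodule.Quotient.surjective_mk' I x
      obtain ⟨y, rfl⟩ := LieSubmodule.Quotient.surjective_mk' I y
      exact f.map_lie x y }

namespace GraphLieAlgebra

variable (K : Type*) [Field K] (k : ℕ) {V : Type*} (G : SimpleGraph V)

/-- The generator of `𝔤(k, G)` given by a vertex. -/
noncomputable def of (v : V) : GraphLieAlgebra K k G :=
  proj (nonEdgeIdeal K k G) (FreeNilpotentLieAlgebra.of K k v)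

theorem lie_of_of_eq_zero {v w : V} (h : ¬ G.Adj v w) : ⁅of K k G v, of K k G w⁆ = 0 := by
  by_cases hvw : v = w
  · rw [hvw, lie_self]
  · rw [of, of, ← LieHom.map_lie]
    exact (LieSubmodule.Quotient.mk_eq_zero _).2
      (LieSubmodule.subset_lieSpan ⟨v, w, hvw, h, rfl⟩)

variable {K k G}

/-- Induction on generators: a property defining a subalgebra need only be checked at the vertices.
-/
theorem mem_of_forall_of_mem (A : LieSubalgebra K (GraphLieAlgebra K k G))
    (h : ∀ v, of K k G v ∈ A) (x : GraphLieAlgebra K k G) : x ∈ A := by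
  obtain ⟨y, rfl⟩ := proj_surjective _ x
  obtain ⟨y, rfl⟩ := proj_surjective _ y
  have := subalgebra_eq_top (A.comap ((proj (nonEdgeIdeal K k G)).comp (proj _))) h
  have hy : y ∈ A.comap ((proj (nonEdgeIdeal K k G)).comp (proj _)) := by rw [this]; trivial
  exact hy

section Lift

variable {M : Type*} [LieRing M] [LieAlgebra K M]

/-- A family of elements of a `k`-step nilpotent Lie algebra, such that those of non-adjacent
vertices commute, defines a homomorphism from `𝔤(k, G)`. -/
theorem exists_lift (hM : LieModule.lowerCentralSeries K M M k = ⊥) (m : V → M)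
    (hm : ∀ v w, ¬ G.Adj v w → ⁅m v, m w⁆ = 0) :
    ∃ f : GraphLieAlgebra K k G →ₗ⁅K⁆ M, ∀ v, f (of K k G v) = m v := by
  let f₁ : FreeNilpotentLieAlgebra K k V →ₗ⁅K⁆ M :=
    LieIdeal.quotientLift _ (FreeLieAlgebra.lift K m) (by
      intro x hx
      have := LieHom.map_lowerCentralSeries_mem (FreeLieAlgebra.lift K m) hx
      rwa [hM, LieSubmodule.mem_bot] at this)
  have hf₁ : ∀ v, f₁ (FreeNilpotentLieAlgebra.of K k v) = m v := fun v =>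
    FreeLieAlgebra.lift_of_apply m v
  refine ⟨LieIdeal.quotientLift _ f₁ ?_, hf₁⟩
  rw [nonEdgeIdeal, LieSubmodule.lieSpan_le]
  rintro _ ⟨v, w, -, hvw, rfl⟩
  simp [LieHom.mem_ker, hf₁, hm v w hvw]

end Lift

theorem lie_eq_zero_of_forall_not_adj (h : ∀ v w, ¬ G.Adj v w) (x y : GraphLieAlgebra K k G) :
    ⁅x, y⁆ = 0 := by
  have h₁ : ∀ v, ∀ x : GraphLieAlgebra K k G, ⁅x, of K k G v⁆ = 0 := fun v x =>
    mem_of_forall_of_mem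
      { carrier := {x | ⁅x, of K k G v⁆ = 0}
        add_mem' := fun {a b} ha hb => by
          simp only [Set.mem_ofPred_eq] at *; rw [add_lie, ha, hb, add_zero]
        zero_mem' := zero_lie _
        smul_mem' := fun c a ha => by simp only [Set.mem_ofPred_eq] at *; rw [smul_lie, ha, smul_zero]
        lie_mem' := fun {a b} ha hb => by
          simp only [Set.mem_ofPred_eq] at *; simp [lie_lie, ha, hb] }
      (fun w => lie_of_of_eq_zero K k G (h w v)) x
  exact mem_of_forall_of_mem
      { carrier := {y | ⁅x, y⁆ = 0}
        add_mem' := fun {a b} ha hb => by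
          simp only [Set.mem_ofPred_eq] at *; rw [lie_add, ha, hb, add_zero]
        zero_mem' := lie_zero _
        smul_mem' := fun c a ha => by simp only [Set.mem_ofPred_eq] at *; rw [lie_smul, ha, smul_zero]
        lie_mem' := fun {a b} ha hb => by
          simp only [Set.mem_ofPred_eq] at *; simp [leibniz_lie, ha, hb] }
      (fun v => h₁ v x) y

end GraphLieAlgebra

/-! ### The two-step graph Lie algebra in coordinates -/

/-- The space `K^V × K^(V × V)`, with the two-step bracket given by the minors of pairs of vectors
of `K^V` at the edges of `G`. -/
def EdgeLieAlgebra (K : Type*) [Field K] {V : Type*} (_ : SimpleGraph V) :=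
  (V → K) × (V → V → K)

namespace EdgeLieAlgebra

variable {K : Type*} [Field K] {V : Type*} {G : SimpleGraph V}

instance : AddCommGroup (EdgeLieAlgebra K G) :=
  inferInstanceAs (AddCommGroup ((V → K) × (V → V → K)))

instance : Module K (EdgeLieAlgebra K G) := inferInstanceAs (Module K ((V → K) × (V → V → K)))

/-- The first component, as a linear map. -/
def fstₗ : EdgeLieAlgebra K G →ₗ[K] (V → K) := LinearMap.fst K (V → K) (V → V → K)

open Classical in
/-- The basis vector of `K^V` given by a vertex. -/
noncomputable def single (v : V) : EdgeLieAlgebra K G := (Pi.single v 1, 0)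

theorem fstₗ_single [inst : DecidableEq V] (v : V) :
    fstₗ (single v : EdgeLieAlgebra K G) = Pi.single v 1 := by
  obtain rfl : inst = fun a b => Classical.propDecidable (a = b) := Subsingleton.elim _ _
  rfl

open Classical in
/-- The minors of a pair of vectors at the edges of `G`. -/
noncomputable def minors (G : SimpleGraph V) (x y : V → K) : V → V → K :=
  fun i j => if G.Adj i j then x i * y j - x j * y i else 0

theorem minors_add_left (x x' y : V → K) : minors G (x + x') y = minors G x y + minors G x' y := by
  ext i j; simp only [minors, Pi.add_apply]; split_ifs <;> ring

theorem minors_add_right (x y y' : V → K) : minors G x (y + y') = minors G x y + minors G x y' := by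
  ext i j; simp only [minors, Pi.add_apply]; split_ifs <;> ring

theorem minors_smul_right (c : K) (x y : V → K) : minors G x (c • y) = c • minors G x y := by
  ext i j; simp only [minors, Pi.smul_apply, smul_eq_mul]; split_ifs <;> ring

theorem minors_self (x : V → K) : minors G x x = 0 := by
  ext i j; simp only [minors, Pi.zero_apply]; split_ifs <;> ring

theorem minors_zero_right (x : V → K) : minors G x 0 = 0 := by
  ext i j; simp [minors]

theorem minors_zero_left (x : V → K) : minors G 0 x = 0 := by
  ext i j; simp [minors]

noncomputable instance : Bracket (EdgeLieAlgebra K G) (EdgeLieAlgebra K G) :=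
  ⟨fun x y => (0, minors G x.1 y.1)⟩

theorem lie_def (x y : EdgeLieAlgebra K G) : ⁅x, y⁆ = (0, minors G x.1 y.1) := rfl

noncomputable instance : LieRing (EdgeLieAlgebra K G) where
  add_lie x y z := Prod.ext (add_zero (0 : V → K)).symm (minors_add_left x.1 y.1 z.1)
  lie_add x y z := Prod.ext (add_zero (0 : V → K)).symm (minors_add_right x.1 y.1 z.1)
  lie_self x := Prod.ext rfl (minors_self x.1)
  leibniz_lie x y z := Prod.ext (add_zero (0 : V → K)).symm (by
    change minors G x.1 0 = minors G 0 z.1 + minors G y.1 0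
    simp [minors_zero_left, minors_zero_right])

noncomputable instance : LieAlgebra K (EdgeLieAlgebra K G) where
  lie_smul c x y := Prod.ext (smul_zero c).symm (minors_smul_right c x.1 y.1)

theorem lowerCentralSeries_two :
    LieModule.lowerCentralSeries K (EdgeLieAlgebra K G) (EdgeLieAlgebra K G) 2 = ⊥ := by
  rw [eq_bot_iff]
  intro x hx
  have := LieModule.lowerCentralSeries_le_of_lie_mem (K := K) (M := EdgeLieAlgebra K G)
    (fun | 0 => ⊤ | 1 => LinearMap.ker fstₗ | _ + 2 => ⊥) rfl (by
      rintro (_ | _ | i) x m hm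
      · exact LinearMap.mem_ker.2 rfl
      · have h0 : m.1 = 0 := hm
        change _ = _
        rw [lie_def, h0, minors_zero_right]; rfl
      · have h0 : m = 0 := hm
        change _ = _
        rw [h0, lie_zero]) 2 hx
  exact this

end EdgeLieAlgebra

/-! ### Filiform Lie algebras -/

/-- The space `K × R`, with the bracket for which `(1, 0)` acts on the abelian ideal `R` by
multiplication with `ε`. -/
def FiliformLieAlgebra (K : Type*) {R : Type*} (_ : R) := K × R

namespace FiliformLieAlgebra

variable {K R : Type*} [Field K] [CommRing R] [Algebra K R] {ε : R}

instance : AddCommGroup (FiliformLieAlgebra K ε) := inferInstanceAs (AddCommGroup (K × R))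

instance : Module K (FiliformLieAlgebra K ε) := inferInstanceAs (Module K (K × R))

/-- The element with given components. -/
def mk (ε : R) (a : K) (p : R) : FiliformLieAlgebra K ε := (a, p)

/-- The first component, as a linear map. -/
def fstₗ : FiliformLieAlgebra K ε →ₗ[K] K := LinearMap.fst K K R

/-- The second component, as a linear map. -/
def sndₗ : FiliformLieAlgebra K ε →ₗ[K] R := LinearMap.snd K K R

@[simp]
theorem fstₗ_mk (a : K) (p : R) : fstₗ (mk ε a p) = a := rfl

@[simp]
theorem sndₗ_mk (a : K) (p : R) : sndₗ (mk ε a p) = p := rfl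

theorem ext_components {x y : FiliformLieAlgebra K ε} (h₁ : fstₗ x = fstₗ y)
    (h₂ : sndₗ x = sndₗ y) : x = y :=
  Prod.ext h₁ h₂

instance : Bracket (FiliformLieAlgebra K ε) (FiliformLieAlgebra K ε) :=
  ⟨fun x y => mk ε 0 (ε * (fstₗ x • sndₗ y - fstₗ y • sndₗ x))⟩

theorem fstₗ_lie (x y : FiliformLieAlgebra K ε) : fstₗ ⁅x, y⁆ = 0 := rfl

theorem sndₗ_lie (x y : FiliformLieAlgebra K ε) :
    sndₗ ⁅x, y⁆ = ε * (fstₗ x • sndₗ y - fstₗ y • sndₗ x) := rfl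

instance : LieRing (FiliformLieAlgebra K ε) where
  add_lie x y z := ext_components (by simp [fstₗ_lie]) (by
    simp only [sndₗ_lie, Algebra.smul_def, map_add]; ring)
  lie_add x y z := ext_components (by simp [fstₗ_lie]) (by
    simp only [sndₗ_lie, Algebra.smul_def, map_add]; ring)
  lie_self x := ext_components (by simp [fstₗ_lie]) (by simp [sndₗ_lie])
  leibniz_lie x y z := ext_components (by simp [fstₗ_lie]) (by
    simp only [sndₗ_lie, fstₗ_lie, Algebra.smul_def, map_add, map_zero]; ring)

instance : LieAlgebra K (FiliformLieAlgebra K ε) where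
  lie_smul c x y := ext_components (by simp [fstₗ_lie]) (by
    simp only [sndₗ_lie, map_smul, smul_eq_mul, Algebra.smul_def, map_mul]; ring)

theorem lie_eq_zero {x y : FiliformLieAlgebra K ε} (hx : fstₗ x = 0) (hy : fstₗ y = 0) :
    ⁅x, y⁆ = 0 :=
  ext_components (by simp [fstₗ_lie]) (by simp [sndₗ_lie, hx, hy])

theorem lie_mk_one_zero (p : R) :
    ⁅mk ε (1 : K) 0, mk ε (0 : K) p⁆ = mk ε 0 (ε * p) :=
  ext_components (by simp [fstₗ_lie]) (by simp [sndₗ_lie])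

theorem lowerCentralSeries_eq_bot {k : ℕ} (hk : 0 < k) (hε : ε ^ k = 0) :
    LieModule.lowerCentralSeries K (FiliformLieAlgebra K ε) (FiliformLieAlgebra K ε) k = ⊥ := by
  obtain ⟨k, rfl⟩ : ∃ j, k = j + 1 := ⟨k - 1, by omega⟩
  rw [eq_bot_iff]
  intro x hx
  have := LieModule.lowerCentralSeries_le_of_lie_mem (K := K) (M := FiliformLieAlgebra K ε)
    -- The filtration is `0 × ε^i R` for `i ≥ 1`: the first bracket kills the `K`-component and
    -- yields one factor `ε`, and each further bracket yields one more.
    (fun | 0 => ⊤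
         | i + 1 => LinearMap.ker fstₗ ⊓
            ((Ideal.span {ε ^ (i + 1)}).restrictScalars K).comap sndₗ) rfl (by
      rintro (_ | i) x m hm
      · refine ⟨LinearMap.mem_ker.2 rfl, Ideal.mem_span_singleton.2 ?_⟩
        exact dvd_trans (dvd_of_eq (pow_one _)) (dvd_mul_right _ _)
      · refine ⟨LinearMap.mem_ker.2 rfl, Ideal.mem_span_singleton.2 ?_⟩
        have h0 : fstₗ m = 0 := hm.1
        have h1 : ε ^ (i + 1) ∣ sndₗ m := Ideal.mem_span_singleton.1 hm.2
        rw [sndₗ_lie, h0, zero_smul, sub_zero, pow_succ' _ (i + 1), Algebra.smul_def]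
        exact mul_dvd_mul_left _ (Dvd.dvd.mul_left h1 _)) (k + 1) hx
  have h2 : ε ^ (k + 1) ∣ sndₗ x := Ideal.mem_span_singleton.1 this.2
  rw [hε, zero_dvd_iff] at h2
  exact ext_components this.1 h2

end FiliformLieAlgebra

/-! ### Graph Lie algebras are not rigid -/

namespace GraphLieAlgebra

variable {K : Type*} [Field K] {k : ℕ} {V : Type*} {G : SimpleGraph V}

/-! ### Projections to the two-step algebra and to the abelianization -/

open Classical in
theorem exists_hom_edgeLieAlgebra (G : SimpleGraph V) (hk : 2 ≤ k) :
    ∃ τ : GraphLieAlgebra K k G →ₗ⁅K⁆ EdgeLieAlgebra K G,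
      ∀ v, τ (of K k G v) = EdgeLieAlgebra.single v := by
  refine exists_lift (M := EdgeLieAlgebra K G) ?_ EdgeLieAlgebra.single ?_
  · have := LieModule.antitone_lowerCentralSeries K (EdgeLieAlgebra K G) (EdgeLieAlgebra K G) hk
    rwa [EdgeLieAlgebra.lowerCentralSeries_two, le_bot_iff] at this
  · intro v w hvw
    refine Prod.ext rfl ?_
    change EdgeLieAlgebra.minors G (Pi.single v 1) (Pi.single w 1) = 0
    ext i j
    simp only [EdgeLieAlgebra.minors, Pi.zero_apply, ite_eq_right_iff, Pi.single_apply]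
    intro hij
    -- A minor of two basis vectors can be nonzero only at the positions `(v, w)` and `(w, v)`,
    -- which are not edges.
    by_cases h1 : i = v <;> by_cases h2 : j = w <;> by_cases h3 : j = v <;>
      by_cases h4 : i = w <;> simp_all [G.adj_comm]

/-- The homomorphism to the two-step graph Lie algebra in coordinates. -/
noncomputable def toEdge (G : SimpleGraph V) (hk : 2 ≤ k) :
    GraphLieAlgebra K k G →ₗ⁅K⁆ EdgeLieAlgebra K G :=
  (exists_hom_edgeLieAlgebra G hk).choose

/-- The abelianization `𝔤(k, G) → K^V`. -/
noncomputable def abelianize (G : SimpleGraph V) (hk : 2 ≤ k) :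
    GraphLieAlgebra K k G →ₗ[K] (V → K) :=
  EdgeLieAlgebra.fstₗ ∘ₗ (toEdge (K := K) G hk : GraphLieAlgebra K k G →ₗ[K] EdgeLieAlgebra K G)

theorem abelianize_of [DecidableEq V] (hk : 2 ≤ k) (v : V) :
    abelianize G hk (of K k G v) = Pi.single v 1 := by
  change EdgeLieAlgebra.fstₗ (toEdge G hk (of K k G v)) = _
  rw [toEdge, (exists_hom_edgeLieAlgebra G hk).choose_spec v,
    EdgeLieAlgebra.fstₗ_single]

theorem abelianize_lie (hk : 2 ≤ k) (x y : GraphLieAlgebra K k G) :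
    abelianize G hk ⁅x, y⁆ = 0 := by
  change EdgeLieAlgebra.fstₗ (toEdge G hk ⁅x, y⁆) = _
  rw [LieHom.map_lie]
  rfl

/-- The two-step model kills this term of the series, and there a bracket is exactly its edge
minors. -/
theorem minors_abelianize_eq_zero (hk : 2 ≤ k) {x y : GraphLieAlgebra K k G}
    (h : ⁅x, y⁆ ∈
      LieModule.lowerCentralSeries K (GraphLieAlgebra K k G) (GraphLieAlgebra K k G) 2) :
    EdgeLieAlgebra.minors G (abelianize G hk x) (abelianize G hk y) = 0 := by
  have := LieHom.map_lowerCentralSeries_mem (toEdge G hk) h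
  rw [EdgeLieAlgebra.lowerCentralSeries_two, LieSubmodule.mem_bot, LieHom.map_lie] at this
  exact congrArg Prod.snd this

/-! ### Linear combinations of vertices -/

variable (K k G) in
/-- The linear combination of the generators with given coefficients. -/
noncomputable def linearCombination [Fintype V] : (V → K) →ₗ[K] GraphLieAlgebra K k G :=
  Fintype.linearCombination K (of K k G)

theorem linearCombination_apply [Fintype V] (c : V → K) :
    linearCombination K k G c = ∑ v, c v • of K k G v := rfl

/-- Expanding the bracket bilinearly and antisymmetrizing turns the coefficients into minors, at the
cost of a factor 2. So commuting modulo 𝔤² implies commuting for such elements. -/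
theorem lie_linearCombination_eq_zero [Fintype V] [CharZero K] {x y : V → K}
    (h : EdgeLieAlgebra.minors G x y = 0) :
    ⁅linearCombination K k G x, linearCombination K k G y⁆ = 0 := by
  have h₁ : ∀ x y : V → K, ⁅linearCombination K k G x, linearCombination K k G y⁆ =
      ∑ i, ∑ j, (x i * y j) • ⁅of K k G i, of K k G j⁆ := by
    intro x y
    simp only [linearCombination_apply, sum_lie, lie_sum, smul_lie, lie_smul, Finset.smul_sum,
      smul_smul]
    rw [Finset.sum_comm]
    simp only [mul_comm]
  have h₂ : ⁅linearCombination K k G x, linearCombination K k G y⁆ -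
      ⁅linearCombination K k G y, linearCombination K k G x⁆ = 0 := by
    rw [h₁, h₁, ← Finset.sum_sub_distrib]
    refine Finset.sum_eq_zero fun i _ => ?_
    rw [← Finset.sum_sub_distrib]
    refine Finset.sum_eq_zero fun j _ => ?_
    rw [← sub_smul]
    by_cases hij : G.Adj i j
    · have := congrFun (congrFun h i) j
      simp only [EdgeLieAlgebra.minors, hij, if_true, Pi.zero_apply] at this
      rw [mul_comm (y i), this, zero_smul]
    · rw [lie_of_of_eq_zero K k G hij, smul_zero]
  rw [← lie_skew (linearCombination K k G y), sub_neg_eq_add, ← two_smul K] at h₂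
  exact (smul_eq_zero.1 h₂).resolve_left two_ne_zero

/-- Only the images of `u` and `v` can fail to commute, and they are adjacent, so all relations
hold. -/
theorem exists_hom_filiform {R : Type*} [CommRing R] [Algebra K R] {ε : R} (hk : 0 < k) (hε : ε ^ k = 0)
    {u v : V} (huv : G.Adj u v) :
    ∃ π : GraphLieAlgebra K k G →ₗ⁅K⁆ FiliformLieAlgebra K ε,
      π (of K k G u) = FiliformLieAlgebra.mk ε 1 0 ∧
      π (of K k G v) = FiliformLieAlgebra.mk ε 0 1 ∧
      ∀ w, w ≠ u → w ≠ v → π (of K k G w) = 0 := by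
  classical
  obtain ⟨π, hπ⟩ := exists_lift (G := G) (FiliformLieAlgebra.lowerCentralSeries_eq_bot hk hε)
    (fun w => if w = u then FiliformLieAlgebra.mk ε (1 : K) 0
      else if w = v then FiliformLieAlgebra.mk ε 0 1 else 0) (by
    intro w w' h
    by_cases h₁ : w = u <;> by_cases h₂ : w' = u <;> by_cases h₃ : w = v <;>
      by_cases h₄ : w' = v <;> simp_all [G.adj_comm])
  exact ⟨π, by simp [hπ], by simp [hπ, huv.ne'], fun w h₁ h₂ => by simp [hπ, h₁, h₂]⟩

variable (K k G) in
/-- The iterated bracket of `v` with `i` copies of `u`. -/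
noncomputable def adPow (u v : V) : ℕ → GraphLieAlgebra K k G
  | 0 => of K k G v
  | i + 1 => ⁅of K k G u, adPow u v i⁆

theorem adPow_mem_lowerCentralSeries (u v : V) (i : ℕ) :
    adPow K k G u v i ∈
      LieModule.lowerCentralSeries K (GraphLieAlgebra K k G) (GraphLieAlgebra K k G) i := by
  induction i with
  | zero => simp
  | succ i ih =>
    rw [LieModule.lowerCentralSeries_succ]
    exact LieSubmodule.lie_mem_lie (LieSubmodule.mem_top _) ih

theorem map_adPow {R : Type*} [CommRing R] [Algebra K R] {ε : R}
    (π : GraphLieAlgebra K k G →ₗ⁅K⁆ FiliformLieAlgebra K ε) {u v : V}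
    (hu : π (of K k G u) = FiliformLieAlgebra.mk ε 1 0)
    (hv : π (of K k G v) = FiliformLieAlgebra.mk ε 0 1) (i : ℕ) :
    π (adPow K k G u v i) = FiliformLieAlgebra.mk ε 0 (ε ^ i) := by
  induction i with
  | zero => simpa [adPow] using hv
  | succ i ih => rw [adPow, LieHom.map_lie, hu, ih, FiliformLieAlgebra.lie_mk_one_zero, pow_succ']

/-- A bijective linear map that is multiplicative modulo the third term of the descending central
series can be composed with an automorphism so that it is the identity on the abelianization. -/
theorem exists_abelianize_eq_single [Fintype V] [DecidableEq V] [CharZero K] (hk : 2 ≤ k)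
    (f : GraphLieAlgebra K k G ≃ₗ[K] GraphLieAlgebra K k G)
    (hf : ∀ x y : GraphLieAlgebra K k G, f ⁅x, y⁆ - ⁅f x, f y⁆ ∈
      LieModule.lowerCentralSeries K (GraphLieAlgebra K k G) (GraphLieAlgebra K k G) 2)
    {v w : V} (hvw : ¬ G.Adj v w) :
    ∃ x y : GraphLieAlgebra K k G, ⁅x, y⁆ = 0 ∧ abelianize G hk (f x) = Pi.single v 1 ∧
      abelianize G hk (f y) = Pi.single w 1 := by
  set a := abelianize (K := K) G hk
  set ι := linearCombination K k G
  have haι : ∀ c, a (ι c) = c := by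
    intro c
    rw [linearCombination_apply, map_sum]
    ext i
    simp [a, abelianize_of, Pi.single_apply]
  have hιv : ∀ v, ι (Pi.single v 1) = of K k G v := by
    intro v
    simp [ι, linearCombination_apply, Pi.single_apply]
  have haf : ∀ x y : GraphLieAlgebra K k G, a (f ⁅x, y⁆) = 0 := by
    intro x y
    have h2 : ∀ m ∈ LieModule.lowerCentralSeries K (GraphLieAlgebra K k G)
        (GraphLieAlgebra K k G) 2, a m = 0 := by
      intro m hm
      rw [LieModule.lowerCentralSeries_succ] at hm
      have hm' : m ∈ (⁅(⊤ : LieIdeal K (GraphLieAlgebra K k G)), LieModule.lowerCentralSeries K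
        (GraphLieAlgebra K k G) (GraphLieAlgebra K k G) 1⁆).toSubmodule := hm
      rw [LieSubmodule.lieIdeal_oper_eq_linear_span'] at hm'
      refine Submodule.span_induction ?_ (map_zero a) ?_ ?_ hm'
      · rintro _ ⟨x, -, y, -, rfl⟩
        exact abelianize_lie hk x y
      · intro x y _ _ hx hy
        rw [map_add, hx, hy, add_zero]
      · intro c x _ hx
        rw [map_smul, hx, smul_zero]
    have := h2 _ (hf x y)
    rwa [map_sub, abelianize_lie, sub_zero] at this
  -- The linear part of `f`, that is, the map it induces on the abelianization.
  let T : (V → K) →ₗ[K] (V → K) := a ∘ₗ f.toLinearMap ∘ₗ ι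
  -- elements agree with their linear part up to brackets
  have hlin : ∀ x, a (f x) = T (a x) := by
    have hmem : ∀ x, x ∈ LinearMap.eqLocus (a ∘ₗ f.toLinearMap) (T ∘ₗ a) := by
      intro x
      refine mem_of_forall_of_mem
        { LinearMap.eqLocus (a ∘ₗ f.toLinearMap) (T ∘ₗ a) with
          lie_mem' := fun {x y} _ _ => ?_ } (fun v => ?_) x
      · change a (f ⁅x, y⁆) = T (a ⁅x, y⁆)
        rw [haf, abelianize_lie, map_zero]
      · change a (f (of K k G v)) = a (f (ι (a (of K k G v))))
        rw [abelianize_of, hιv]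
    exact hmem
  have hTsurj : Function.Surjective T := by
    intro c
    refine ⟨a (f.symm (ι c)), ?_⟩
    rw [← hlin, LinearEquiv.apply_symm_apply, haι]
  -- `T` respects the relations: for a non-edge the images under `f` commute modulo 𝔤², so their
  -- edge minors vanish and their linear parts commute exactly.
  obtain ⟨h, hh⟩ := exists_lift (G := G) (lowerCentralSeries_eq_bot K k G)
    (fun v => ι (T (Pi.single v 1))) (by
      intro v w hvw
      refine lie_linearCombination_eq_zero ?_
      change EdgeLieAlgebra.minors G (a (f (ι _))) (a (f (ι _))) = 0
      rw [hιv, hιv]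
      refine minors_abelianize_eq_zero hk ?_
      have := hf (of K k G v) (of K k G w)
      rw [lie_of_of_eq_zero K k G hvw, map_zero, zero_sub] at this
      rw [← neg_neg ⁅f (of K k G v), f (of K k G w)⁆]
      exact neg_mem this)
  have hhι : ∀ c, h (ι c) = ι (T c) := by
    have : (h : GraphLieAlgebra K k G →ₗ[K] GraphLieAlgebra K k G) ∘ₗ ι = ι ∘ₗ T := by
      refine LinearMap.pi_ext' fun v => LinearMap.ext_ring ?_
      change h (ι (Pi.single v 1)) = ι (T (Pi.single v 1))
      rw [hιv, hh]
    exact fun c => congrArg (fun g => g c) this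
  have hsurj : Function.Surjective (h : GraphLieAlgebra K k G →ₗ[K] GraphLieAlgebra K k G) := by
    intro x
    refine mem_of_forall_of_mem h.range (fun v => ?_) x
    obtain ⟨c, hc⟩ := hTsurj (Pi.single v 1)
    exact ⟨ι c, by rw [← hιv, ← hc]; exact hhι c⟩
  -- Finite dimensionality makes `h` an automorphism; it sends `⁅ι c, ι d⁆` below to the bracket of
  -- the generators `v` and `w`, which is zero.
  have hinj := LinearMap.injective_iff_surjective.2 hsurj
  obtain ⟨c, hc⟩ := hTsurj (Pi.single v 1)
  obtain ⟨d, hd⟩ := hTsurj (Pi.single w 1)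
  refine ⟨ι c, ι d, hinj ?_, hc, hd⟩
  change h _ = h 0
  rw [LieHom.map_lie, hhι, hhι, hc, hd, hιv, hιv, lie_of_of_eq_zero K k G hvw, map_zero]

theorem not_isKRigid_of_adj [CharZero K] [Fintype V] (hk : 3 ≤ k) {u v w : V} (huv : G.Adj u v)
    (hvw : v ≠ w) (hna : ¬ G.Adj v w) : ¬ IsKRigid K k (GraphLieAlgebra K k G) := by
  classical
  intro hrigid
  have hk2 : 2 ≤ k := by omega
  have hwu : w ≠ u := fun h => hna (h ▸ huv.symm)
  set a := abelianize (K := K) G hk2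
  obtain ⟨j, rfl⟩ : ∃ j, k = j + 3 := ⟨k - 3, by omega⟩
  -- With `k = j + 3`, `z` lies in the term of index `k - 1`: deep enough to be central, and inside
  -- 𝔤² because `k - 1 ≥ 2`.
  set z := adPow K (j + 3) G u v (j + 2) with hz
  have haz : a z = 0 := abelianize_lie hk2 _ _
  obtain ⟨t, ht, f, hf⟩ := hrigid.exists_equiv_deformation hk2
    (lowerCentralSeries_eq_bot K (j + 3) G) (α := LinearMap.proj v ∘ₗ a)
    (β := LinearMap.proj w ∘ₗ a) (z := z)
    (fun x y => congrFun (abelianize_lie hk2 x y) v)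
    (fun x y => congrFun (abelianize_lie hk2 x y) w) (congrFun haz v) (congrFun haz w)
    (fun x => by
      have : ⁅x, z⁆ ∈ LieModule.lowerCentralSeries K (GraphLieAlgebra K (j + 3) G)
          (GraphLieAlgebra K (j + 3) G) (j + 3) := by
        refine (LieModule.lowerCentralSeries_succ K (GraphLieAlgebra K (j + 3) G)
          (GraphLieAlgebra K (j + 3) G) (j + 2)).symm ▸ ?_
        exact LieSubmodule.lie_mem_lie (LieSubmodule.mem_top _)
          (adPow_mem_lowerCentralSeries u v (j + 2))
      rwa [lowerCentralSeries_eq_bot, LieSubmodule.mem_bot] at this)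
  obtain ⟨x, y, hxy, hx, hy⟩ := exists_abelianize_eq_single hk2 f (fun x y => by
    rw [hf, add_sub_cancel_left]
    exact Submodule.smul_mem _ _ (Submodule.smul_mem _ _
      (LieModule.antitone_lowerCentralSeries K _ _ (by omega : 2 ≤ j + 2)
        (adPow_mem_lowerCentralSeries u v (j + 2))))) hna
  -- Becomes `0 = ⁅f x, f y⁆ + t • z`.
  have key := hf x y
  simp only [hxy, map_zero, LinearMap.comp_apply, LinearMap.proj_apply, a, hx, hy,
    Pi.single_eq_same, Pi.single_eq_of_ne hvw, Pi.single_eq_of_ne hvw.symm, mul_zero, sub_zero,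
    one_mul, one_smul] at key
  -- In `K[X]/(X^k)` the class of `X` has nilpotency index exactly `k`, so the image `ε^(k-1)` of
  -- `z` survives.
  let R := AdjoinRoot ((Polynomial.X : Polynomial K) ^ (j + 3))
  let ε : R := AdjoinRoot.mk _ Polynomial.X
  have hε : ε ^ (j + 3) = 0 := by
    rw [← map_pow, AdjoinRoot.mk_self]
  have hε' : ε ^ (j + 2) ≠ 0 := by
    rw [← map_pow, Ne, AdjoinRoot.mk_eq_zero,
      pow_dvd_pow_iff Polynomial.X_ne_zero Polynomial.not_isUnit_X]
    omega
  obtain ⟨π, hπu, hπv, hπ⟩ := exists_hom_filiform (K := K) (G := G) (by omega) hε huv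
  -- The `K`-component of `π` sees only the `u`-coordinate, so `f x` and `f y` land in the abelian
  -- ideal `R` whatever their higher terms.
  have hπ₁ : ∀ x, FiliformLieAlgebra.fstₗ (π x) = a x u := by
    intro x
    refine mem_of_forall_of_mem
      { LinearMap.eqLocus (FiliformLieAlgebra.fstₗ ∘ₗ
          (π : GraphLieAlgebra K (j + 3) G →ₗ[K] FiliformLieAlgebra K ε)) (LinearMap.proj u ∘ₗ a)
          with
        lie_mem' := fun {x y} _ _ => ?_ } (fun i => ?_) x
    · change FiliformLieAlgebra.fstₗ (π ⁅x, y⁆) = a ⁅x, y⁆ u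
      rw [LieHom.map_lie, FiliformLieAlgebra.fstₗ_lie, abelianize_lie, Pi.zero_apply]
    · change FiliformLieAlgebra.fstₗ (π (of K (j + 3) G i)) = a (of K (j + 3) G i) u
      rw [abelianize_of]
      by_cases hi : i = u
      · rw [hi, hπu, Pi.single_eq_same, FiliformLieAlgebra.fstₗ_mk]
      · rw [Pi.single_eq_of_ne (Ne.symm hi)]
        by_cases hi' : i = v
        · rw [hi', hπv, FiliformLieAlgebra.fstₗ_mk]
        · rw [hπ i hi hi', map_zero]
  have h₀ : π ⁅f x, f y⁆ = 0 := by
    rw [LieHom.map_lie]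
    refine FiliformLieAlgebra.lie_eq_zero ?_ ?_
    · rw [hπ₁, hx, Pi.single_eq_of_ne huv.ne]
    · rw [hπ₁, hy, Pi.single_eq_of_ne hwu.symm]
  have h₁ := congrArg (fun m => FiliformLieAlgebra.sndₗ (π m)) key
  simp only [map_zero, map_add, map_smul, h₀, hz, map_adPow π hπu hπv,
    FiliformLieAlgebra.sndₗ_mk, zero_add] at h₁
  exact (smul_ne_zero ht hε') h₁.symm

/-- The algebra is abelian, while the deformation has the Heisenberg bracket of `v` and `w` equal to
`t u`; this is why three distinct vertices are needed. -/
theorem not_isKRigid_of_forall_not_adj [CharZero K] [Fintype V] (hk : 2 ≤ k)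
    (hG : ∀ v w, ¬ G.Adj v w) {u v w : V} (huv : u ≠ v) (huw : u ≠ w) (hvw : v ≠ w) :
    ¬ IsKRigid K k (GraphLieAlgebra K k G) := by
  classical
  intro hrigid
  set a := abelianize (K := K) G hk
  obtain ⟨t, ht, f, hf⟩ := hrigid.exists_equiv_deformation hk
    (lowerCentralSeries_eq_bot K k G) (α := LinearMap.proj v ∘ₗ a)
    (β := LinearMap.proj w ∘ₗ a) (z := of K k G u)
    (fun x y => congrFun (abelianize_lie hk x y) v)
    (fun x y => congrFun (abelianize_lie hk x y) w)
    (by simp [a, abelianize_of, huv.symm]) (by simp [a, abelianize_of, huw.symm])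
    (fun x => lie_eq_zero_of_forall_not_adj hG x _)
  -- At the preimages of `v` and `w` the deformation term is `t u`, so its `u`-coordinate is `t`.
  have key := congrArg (fun m => a m u) (hf (f.symm (of K k G v)) (f.symm (of K k G w)))
  simp [lie_eq_zero_of_forall_not_adj hG, a, abelianize_of, hvw, hvw.symm] at key
  exact ht key.symm

end GraphLieAlgebra

theorem mainTheorem2 {K : Type*} [Field K] [IsAlgClosed K] [CharZero K]
    {V : Type*} [Fintype V] (G : SimpleGraph V) (hV : 3 ≤ Fintype.card V) (hG : G ≠ ⊤)
    (k : ℕ) (hk : 3 ≤ k) :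
    ¬ IsKRigid K k (GraphLieAlgebra K k G) := by
  classical
  by_cases h : ∃ u v w, G.Adj u v ∧ v ≠ w ∧ ¬ G.Adj v w
  · obtain ⟨u, v, w, huv, hvw, hna⟩ := h
    exact GraphLieAlgebra.not_isKRigid_of_adj hk huv hvw hna
  · push Not at h
    have hno : ∀ x y, ¬ G.Adj x y := by
      intro x y hxy
      -- a vertex with a neighbour is adjacent to all others, so the graph is complete
      refine hG (SimpleGraph.ext ?_)
      ext v w
      simp only [SimpleGraph.top_adj]
      refine ⟨fun hvw => hvw.ne, fun hvw => ?_⟩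
      by_cases hv : y = v
      · exact hv ▸ h x y w hxy (hv ▸ hvw)
      · exact h y v w (h x y v hxy hv) hvw
    obtain ⟨u, v, w, huv, huw, hvw⟩ := Fintype.two_lt_card_iff.1 hV
    exact GraphLieAlgebra.not_isKRigid_of_forall_not_adj (by omega) hno huv huw hvw
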